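/- A cover of a finite simple graph $G$ is a pair $\mathcal H=(L,H)$ of a finite simple graph $H$ and a map $L$ assigning to each $u\in V(G)$ a set $L(u)\subseteq V(H)$ such that: the sets $L(u)$, $u\in V(G)$, are nonempty, pairwise disjoint and have union $V(H)$; each $L(u)$ induces a complete subgraph of $H$; if $H$ has an edge with one endpoint in $L(u)$ and the other in $L(v)$, then $u=v$ or $uv\in E(G)$; and if $uv\in E(G)$, the edges of $H$ between $L(u)$ and $L(v)$ form a (possibly empty) matching. The cover is $m$-fold if $|L(u)|=m$ for all $u$. An $\mathcal H$-coloring of $G$ is an independent set of $H$ of size $|V(G)|$. For an integer $m\ge 1$, the DP color function $P_{DP}(G,m)$ is the minimum, over all $m$-fold covers $\mathcal H$ of $G$, of the number of $\mathcal H$-colorings of $G$, and $P(G,m)$ is the number of proper colorings of $G$ with $m$ colors. The DP color function threshold $\tau_{DP}(G)$ is the smallest integer $N\ge\chi(G)$ such that $P_{DP}(G,m)=P(G,m)$ for all $m\ge N$ ($\infty$ if there is no such $N$). **Proposition.** Let $n\ge 2$ and let $k_1,\dots,k_n\ge 3$ be integers such that $k_p=4$ for at most one index $p$. Let $M=K_1\vee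 G$ be the cone of $G$ (the join of $G$ with a single vertex), where $G$ is the disjoint union of the cycles $C_{k_1},\dots,C_{k_n}$. Then $$P_{DP}(M,4)=P(M,4),$$ and consequently $\tau_{DP}(M)=4$. -/

import Mathlib

namespace DPColoring

/-- The join `G ∨ H` of two vertex-disjoint graphs: their disjoint sum together with all edges
between the two parts. -/
def join {V W : Type*} (G : SimpleGraph V) (H : SimpleGraph W) : SimpleGraph (V ⊕ W) :=
  SimpleGraph.sum G H ⊔ completeBipartiteGraph V W

/-- The cone `K₁ ∨ G` of a graph `G`. -/
def cone {V : Type*} (G : SimpleGraph V) : SimpleGraph (Unit ⊕ V) :=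
  join (SimpleGraph.completeGraph Unit) G

/-- The disjoint union of a family of graphs. -/
def disjointUnion {ι : Type*} {V : ι → Type*} (G : ∀ i, SimpleGraph (V i)) :
    SimpleGraph (Σ i, V i) :=
  ⨆ i, (G i).map (Function.Embedding.sigmaMk i)

/-- `(L, H)` is a cover of `G`. -/
structure IsCover {V W : Type*} (G : SimpleGraph V) (H : SimpleGraph W) (L : V → Set W) :
    Prop where
  /-- The sets `L u` form a partition of the vertices of `H` (in particular, they are nonempty) ... -/
  isPartition : Setoid.IsPartition (Set.range L)
  /-- ... which has one part for each vertex of `G`. -/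
  injective : Function.Injective L
  /-- Each `L u` induces a complete subgraph of `H`. -/
  isClique : ∀ u, H.IsClique (L u)
  /-- Edges of `H` join vertices in the same part, or in parts of adjacent vertices of `G`. -/
  eq_or_adj : ∀ ⦃u v : V⦄ ⦃a b : W⦄, a ∈ L u → b ∈ L v → H.Adj a b → u = v ∨ G.Adj u v
  /-- For adjacent `u, v` the edges between `L u` and `L v` form a (possibly empty) matching.
  As `(u, v)` ranges over ordered pairs, no endpoint on either side is shared. -/
  matching : ∀ ⦃u v : V⦄, G.Adj u v → ∀ ⦃a b c : W⦄, a ∈ L u → b ∈ L v → c ∈ L v →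
    H.Adj a b → H.Adj a c → b = c

/-- All parts of the cover have size `m`. -/
def IsFold {V W : Type*} (L : V → Set W) (m : ℕ) : Prop :=
  ∀ u, (L u).ncard = m

/-- The colorings of `G` from a cover with cover graph `H`: the independent sets of `H` of size
`|V(G)|`. -/
def coverColorings (V : Type*) {W : Type*} (H : SimpleGraph W) : Set (Set W) :=
  {I | H.IsIndepSet I ∧ I.ncard = Nat.card V}

/-- The numbers `P_DP(G, (L, H))` for all `m`-fold covers `(L, H)` of `G`. The cover of a finite
graph is finite, so it is enough to take cover graphs in `Type`. -/
def coverCounts {V : Type*} (G : SimpleGraph V) (m : ℕ) : Set ℕ :=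
  {c | ∃ (W : Type) (_ : Finite W) (H : SimpleGraph W) (L : V → Set W),
    IsCover G H L ∧ IsFold L m ∧ c = (coverColorings V H).ncard}

/-- The DP color function `P_DP(G, m)`, for `m ≥ 1`. -/
noncomputable def dpColorFunction {V : Type*} (G : SimpleGraph V) (m : ℕ) : ℕ :=
  sInf (coverCounts G m)

/-- The chromatic polynomial `P(G, m)`: the number of proper `m`-colorings of `G`. -/
noncomputable def chromaticCount {V : Type*} (G : SimpleGraph V) (m : ℕ) : ℕ :=
  Nat.card (G.Coloring (Fin m))

/-- The DP color function threshold `τ_DP(G)`: the least `N ≥ χ(G)` such that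
`P_DP(G, m) = P(G, m)` for all `m ≥ N`, and `∞` if there is none. -/
noncomputable def dpThreshold {V : Type*} (G : SimpleGraph V) : ℕ∞ :=
  ⨅ (N : ℕ) (_ : G.chromaticNumber ≤ N ∧
    ∀ m : ℕ, N ≤ m → dpColorFunction G m = chromaticCount G m), (N : ℕ∞)

/-- Covers exist, so the minimum that defines the DP color function is attained. -/
theorem dpColorFunction_isLeast {V : Type*} [Finite V] (G : SimpleGraph V) {m : ℕ} (hm : 1 ≤ m) :
    IsLeast (coverCounts G m) (dpColorFunction G m) := by
  have hne : (coverCounts G m).Nonempty := by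
    obtain ⟨n, ⟨e⟩⟩ := Finite.exists_equiv_fin V
    let H : SimpleGraph (Fin n × Fin m) :=
      { Adj := fun a b => a.1 = b.1 ∧ a ≠ b
        symm := ⟨fun a b h => ⟨h.1.symm, h.2.symm⟩⟩
        loopless := ⟨fun a h => h.2 rfl⟩ }
    let L : V → Set (Fin n × Fin m) := fun u => {a | a.1 = e u}
    refine ⟨_, Fin n × Fin m, inferInstance, H, L, ⟨⟨?_, ?_⟩, ?_, ?_, ?_, ?_⟩, ?_, rfl⟩
    · rintro ⟨u, hu⟩
      have : (e u, (⟨0, hm⟩ : Fin m)) ∈ L u := rfl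
      rw [hu] at this
      exact this
    · intro a
      refine ⟨L (e.symm a.1), ⟨⟨_, rfl⟩, by simp [L]⟩, ?_⟩
      rintro _ ⟨⟨u, rfl⟩, h⟩
      have h' : a.1 = e u := h
      rw [h', e.symm_apply_apply]
    · intro u v h
      have : (e u, (⟨0, hm⟩ : Fin m)) ∈ L v := h ▸ (rfl : (e u, (⟨0, hm⟩ : Fin m)) ∈ L u)
      exact e.injective this
    · intro u a ha b hb hab
      exact ⟨Eq.trans ha (Eq.symm hb), hab⟩
    · intro u v a b ha hb hab
      exact Or.inl (e.injective ((Eq.symm ha).trans (hab.1.trans hb)))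
    · intro u v huv a b c ha hb _ hab _
      exact absurd (e.injective ((Eq.symm ha).trans (hab.1.trans hb))) huv.ne
    · intro u
      have : L u = Set.range (fun j : Fin m => (e u, j)) := by
        ext ⟨i, j⟩
        simp [L, eq_comm]
      rw [this, Set.ncard_range_of_injective (fun i j h => (Prod.ext_iff.1 h).2)]
      simp
  exact ⟨Nat.sInf_mem hne, fun c hc => Nat.sInf_le hc⟩

end DPColoring

namespace DPColoring

open Finset

/-! The spokes form a spanning star of the cone. After enlarging every matching of a cover to a
perfect one, which can only destroy colorings, the parts can be labelled so that the spokes carry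
the identity and only permutations `σ i t` on the rims remain. The number of colorings is then the
sum over the apex color `j` of the product over the cycles of `twistCount (σ i) j`.

On the `m - 1` colors other than `j`, each rim permutation is a partial injection and extends to a
permutation. Walks avoiding permutations are counted exactly through powers of `J - Q`, with `J` the
all-ones matrix and `Q` a permutation matrix; closed walks depend only on the number of fixed points
of the monodromy. For an odd cycle the untwisted value `P` is therefore minimal for each `j`. For an
even cycle with `e` moved colors the count is at least `P - e` if `j` is unmoved, and at least `P -
e + G` if `j` is moved, because the partial injection then has a missing pair that yields extra
walks (`le_closedWalkCount_of_extra`).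

The cycles are coupled through `j`. By `log x ≥ 1 - 1/x` and `y - 1 ≥ log y`, it suffices that each
cycle separately satisfies `∑ j, w j * (1 - P / N j) ≥ 0` (`sum_le_sum_mul_prod`). The bounds above
give this for `w = 1` when `m ≥ 5`, and for any weights in `[14, 22]` when `m = 4` and the length is
not 4. They do not give it for a 4-cycle with 4 colors, but one 4-cycle can be absorbed: its own
lower bounds serve as the weights (`exists_weights`).

The threshold is not below 4: if the cone is 3-colorable, all cycles are even, and twisting one edge
of one cycle strictly lowers the count at `m = 3`. -/

/-- The number of closed walks of length `n + 1` whose `t`-th step satisfies `R t`. -/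
noncomputable def closedWalkCount {α : Type*} {n : ℕ} (R : Fin (n + 1) → α → α → Prop) : ℕ :=
  Nat.card {c : Fin (n + 1) → α // ∀ t, R t (c t) (c (t + 1))}

theorem closedWalkCount_rotate {α : Type*} {n : ℕ} (R : Fin (n + 1) → α → α → Prop) (s : Fin (n + 1)) :
    closedWalkCount (fun t => R (t + s)) = closedWalkCount R := by
  unfold closedWalkCount
  refine Nat.card_congr (Equiv.subtypeEquiv ((Equiv.addRight s).arrowCongr (Equiv.refl α)) ?_)
  intro c
  simp only [Equiv.arrowCongr_apply, Equiv.coe_refl, Function.comp_apply, id,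
    Equiv.addRight_symm, Equiv.coe_addRight]
  constructor
  · intro h t
    have := h (t + -s)
    rwa [neg_add_cancel_right, show t + -s + 1 = t + 1 + -s by abel] at this
  · intro h t
    have := h (t + s)
    rwa [add_neg_cancel_right, show t + s + 1 + -s = t + 1 by abel] at this

/-! ### Walks whose steps avoid permutations -/

section Walks

variable {α : Type*} [Fintype α]

open Classical in
/-- The number of walks `c 0, …, c n` from `x` to `y` whose `t`-th step satisfies `R t`. -/
noncomputable def walkCount {n : ℕ} (R : Fin n → α → α → Prop) (x y : α) : ℕ :=
  #{c : Fin (n + 1) → α | c 0 = x ∧ c (Fin.last n) = y ∧ ∀ t : Fin n, R t (c t.castSucc) (c t.succ)}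

open Classical in
theorem walkCount_zero (R : Fin 0 → α → α → Prop) (x y : α) :
    walkCount R x y = if y = x then 1 else 0 := by
  unfold walkCount
  split_ifs with h
  · subst h
    rw [Finset.card_eq_one]
    refine ⟨fun _ => y, ?_⟩
    ext c
    simp only [mem_filter, mem_univ, true_and, mem_singleton]
    constructor
    · rintro ⟨h, -⟩
      funext t
      rw [show t = 0 from Fin.ext (by omega), h]
    · rintro rfl
      simp
  · rw [Finset.card_eq_zero]
    ext c
    simp only [mem_filter, mem_univ, true_and, notMem_empty, iff_false]
    rintro ⟨h1, h2, -⟩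
    exact h (h2.symm.trans h1)

open Classical in
theorem walkCount_succ {n : ℕ} (R : Fin (n + 1) → α → α → Prop) (x y : α) :
    walkCount R x y =
      ∑ z, if R (Fin.last n) z y then walkCount (fun t : Fin n => R t.castSucc) x z else 0 := by
  rw [← Finset.sum_filter]
  unfold walkCount
  rw [← Finset.card_sigma]
  refine Finset.card_bij' (fun c _ => ⟨c (Fin.last n).castSucc, Fin.init c⟩)
    (fun s _ => Fin.snoc s.2 y) ?_ ?_ ?_ ?_
  · intro c hc
    simp only [mem_filter, mem_univ, true_and, mem_sigma] at hc ⊢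
    obtain ⟨h0, h1, h2⟩ := hc
    refine ⟨?_, h0, rfl, fun t => h2 t.castSucc⟩
    have := h2 (Fin.last n)
    rwa [Fin.succ_last, h1] at this
  · rintro ⟨z, c⟩ hc
    simp only [mem_filter, mem_univ, true_and, mem_sigma] at hc ⊢
    obtain ⟨hR, h0, h1, h2⟩ := hc
    refine ⟨?_, Fin.snoc_last _ _, ?_⟩
    · rw [← Fin.castSucc_zero, Fin.snoc_castSucc (α := fun _ => α), h0]
    · intro t
      rw [Fin.snoc_castSucc (α := fun _ => α)]
      induction t using Fin.lastCases with
      | last => rw [Fin.succ_last, Fin.snoc_last, h1]; exact hR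
      | cast t =>
        rw [← Fin.castSucc_succ, Fin.snoc_castSucc (α := fun _ => α)]; exact h2 t
  · intro c hc
    simp only [mem_filter, mem_univ, true_and] at hc
    rw [← hc.2.1]
    exact Fin.snoc_init_self c
  · rintro ⟨z, c⟩ hc
    simp only [mem_filter, mem_univ, true_and, mem_sigma] at hc
    simp only [Fin.init_snoc, Fin.snoc_castSucc (α := fun _ => α), hc.2.2.1]

theorem closedWalkCount_eq_sum {n : ℕ} (R : Fin (n + 1) → α → α → Prop) :
    closedWalkCount R = ∑ x, walkCount R x x := by
  classical
  unfold closedWalkCount walkCount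
  rw [Nat.card_eq_fintype_card, Fintype.card_subtype, ← Finset.card_sigma]
  refine Finset.card_bij' (fun c _ => ⟨c 0, Fin.snoc c (c 0)⟩) (fun s _ => Fin.init s.2) ?_ ?_ ?_ ?_
  · intro c hc
    simp only [mem_filter, mem_univ, true_and, mem_sigma] at hc ⊢
    refine ⟨Fin.snoc_castSucc (α := fun _ => α) (c 0) c 0, Fin.snoc_last _ _, ?_⟩
    · intro t
      rw [Fin.snoc_castSucc (α := fun _ => α)]
      have := hc t
      induction t using Fin.lastCases with
      | last => rw [Fin.succ_last, Fin.snoc_last]; rwa [Fin.last_add_one] at this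
      | cast t =>
        rw [← Fin.castSucc_succ, Fin.snoc_castSucc (α := fun _ => α)]
        rwa [Fin.coeSucc_eq_succ] at this
  · rintro ⟨z, c⟩ hc
    simp only [mem_filter, mem_univ, true_and, mem_sigma] at hc ⊢
    obtain ⟨h0, h1, h2⟩ := hc
    intro t
    have := h2 t
    induction t using Fin.lastCases with
    | last =>
      rw [Fin.last_add_one]
      rw [Fin.succ_last, h1, ← h0] at this
      exact this
    | cast t =>
      rw [Fin.coeSucc_eq_succ]
      rwa [← Fin.castSucc_succ] at this
  · intro c hc
    exact Fin.init_snoc (α := fun _ => α) _ _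
  · rintro ⟨z, c⟩ hc
    simp only [mem_filter, mem_univ, true_and, mem_sigma] at hc
    obtain ⟨h0, h1, h2⟩ := hc
    have h3 : Fin.init c 0 = z := h0
    have h4 : Fin.snoc (Fin.init c) z = c := by
      conv_rhs => rw [← Fin.snoc_init_self c, h1]
    simp only [h3, h4]

theorem walkCount_mono {n : ℕ} {R S : Fin n → α → α → Prop} (h : ∀ t x y, R t x y → S t x y)
    (x y : α) : walkCount R x y ≤ walkCount S x y := by
  classical
  unfold walkCount
  refine Finset.card_le_card fun c hc => ?_
  simp only [mem_filter, mem_univ, true_and] at hc ⊢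
  exact ⟨hc.1, hc.2.1, fun t => h _ _ _ (hc.2.2 t)⟩

theorem closedWalkCount_mono {n : ℕ} {R S : Fin (n + 1) → α → α → Prop}
    (h : ∀ t x y, R t x y → S t x y) : closedWalkCount R ≤ closedWalkCount S := by
  rw [closedWalkCount_eq_sum, closedWalkCount_eq_sum]
  exact Finset.sum_le_sum fun x _ => walkCount_mono h x x

open Classical in
-- Since `J` absorbs permutation matrices, a product of `n` factors `J - Q` is a multiple of `J`
-- plus `(-1) ^ n` times the product permutation `p`. Multiplying by the number of colors keeps the
-- formula integral.
theorem card_mul_walkCount_perm {n : ℕ} (B : Fin n → Equiv.Perm α) :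
    ∃ p : Equiv.Perm α, (∀ z, (∀ t, B t z = z) → p z = z) ∧ ∀ x y,
      (Fintype.card α : ℤ) * walkCount (fun t a b => b ≠ B t a) x y =
        (Fintype.card α - 1) ^ n +
          (-1) ^ n * (if y = p x then (Fintype.card α - 1 : ℤ) else -1) := by
  induction n with
  | zero =>
    refine ⟨1, fun z _ => rfl, fun x y => ?_⟩
    rw [walkCount_zero]
    split_ifs <;> simp_all
  | succ n ih =>
    obtain ⟨p, hp, hW⟩ := ih fun t => B t.castSucc
    obtain ⟨p', hp'⟩ : ∃ p' : Equiv.Perm α, ∀ x, p' x = B (Fin.last n) (p x) :=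
      ⟨B (Fin.last n) * p, fun _ => rfl⟩
    refine ⟨p', fun z hz => ?_, fun x y => ?_⟩
    · rw [hp', hp z fun t => hz _, hz]
    -- The sum over the penultimate vertex `z` is the full row sum minus the one forbidden term, the
    -- preimage of `y`.
    · have key : ∀ z : α, (if y ≠ B (Fin.last n) z then
          (Fintype.card α : ℤ) * walkCount (fun (t : Fin n) a b => b ≠ B t.castSucc a) x z else 0) =
          ((Fintype.card α - 1) ^ n + (-1) ^ n * -1) + (if z = p x then
            (-1) ^ n * (Fintype.card α : ℤ) else 0) -
          (if z = (B (Fin.last n)).symm y then ((Fintype.card α - 1) ^ n + (-1) ^ n * -1) +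
            (if z = p x then (-1) ^ n * (Fintype.card α : ℤ) else 0) else 0) := by
        intro z
        rw [hW]
        have : z = (B (Fin.last n)).symm y ↔ y = B (Fin.last n) z := by
          rw [Equiv.eq_symm_apply, eq_comm]
        rw [this]
        split_ifs <;> first | contradiction | ring
      rw [walkCount_succ]
      push_cast
      rw [Finset.mul_sum]
      simp only [mul_ite, mul_zero]
      rw [Finset.sum_congr rfl fun z _ => key z, Finset.sum_sub_distrib, Finset.sum_add_distrib,
        Finset.sum_const, Finset.sum_ite_eq' , Finset.sum_ite_eq', Finset.card_univ, nsmul_eq_mul]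
      simp only [mem_univ, if_true]
      have : (B (Fin.last n)).symm y = p x ↔ y = p' x := by
        rw [Equiv.symm_apply_eq, hp']
      by_cases h : y = p' x
      · rw [if_pos (this.2 h), if_pos h]; ring
      · rw [if_neg (mt this.1 h), if_neg h]; ring

/-- Closed walks whose steps avoid the permutations `B t` are counted by the number of fixed points
of the monodromy. -/
theorem closedWalkCount_perm [Nonempty α] {n : ℕ} (B : Fin (n + 1) → Equiv.Perm α) :
    ∃ f : ℕ, (∀ F : Finset α, (∀ z ∈ F, ∀ t, B t z = z) → #F ≤ f) ∧ f ≤ Fintype.card α ∧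
      (closedWalkCount (fun t a b => b ≠ B t a) : ℤ) =
        (Fintype.card α - 1) ^ (n + 1) + (-1) ^ (n + 1) * (f - 1) := by
  classical
  obtain ⟨p, hp, hW⟩ := card_mul_walkCount_perm B
  refine ⟨#{z | z = p z}, fun F hF => Finset.card_le_card fun z hz => ?_, Finset.card_le_univ _, ?_⟩
  · simpa using (hp z (hF z hz)).symm
  · have hq : (Fintype.card α : ℤ) ≠ 0 := by exact_mod_cast Fintype.card_ne_zero
    apply mul_left_cancel₀ hq
    rw [closedWalkCount_eq_sum]
    push_cast
    rw [Finset.mul_sum, Finset.sum_congr rfl fun x _ => hW x x, Finset.sum_add_distrib,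
      ← Finset.mul_sum]
    have : ∀ z : α, (if z = p z then (Fintype.card α - 1 : ℤ) else -1) =
        (if z = p z then (Fintype.card α : ℤ) else 0) - 1 := by
      intro z; split_ifs <;> ring
    rw [Finset.sum_congr rfl fun z _ => this z, Finset.sum_sub_distrib, ← Finset.sum_filter]
    simp only [sum_const, nsmul_eq_mul, Finset.card_univ]
    ring

/-- If the last step may in addition use one pair `(a, b)` of the graph of the permutation, there
are more closed walks. -/
theorem le_closedWalkCount_of_extra [Nonempty α] {n : ℕ} (hn : Odd n)
    (B : Fin (n + 1) → Equiv.Perm α) (R : Fin (n + 1) → α → α → Prop)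
    (hR : ∀ t x y, y ≠ B t x → R t x y) (a : α)
    (ha : R (Fin.last n) a (B (Fin.last n) a)) (F : Finset α) (hF : ∀ z ∈ F, ∀ t, B t z = z)
    (haF : B (Fin.last n) a ∉ F) :
    (Fintype.card α : ℤ) * ((Fintype.card α - 1) ^ (n + 1) + #F - 1) +
      (Fintype.card α - 1) ^ n + 1 ≤ Fintype.card α * closedWalkCount R := by
  classical
  set b := B (Fin.last n) a with hb
  obtain ⟨p, hp, hW⟩ := card_mul_walkCount_perm fun t : Fin n => B t.castSucc
  set q : ℤ := (Fintype.card α : ℤ) with hq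
  set W : α → α → ℕ := walkCount (fun (t : Fin n) x y => y ≠ B t.castSucc x) with hWdef
  have hq1 : 1 ≤ q := by
    rw [hq]; exact_mod_cast Fintype.card_pos
  -- Compared with the walks avoiding all `B t`, the walks from `b` to `b` whose last step is `a` to
  -- `b` are regained; there are `W b a` of them.
  have hstep : ∀ x y : α, q * walkCount R x y ≥
      (∑ z, q * W x z) - q * W x ((B (Fin.last n)).symm y) +
        if x = b ∧ y = b then q * W b a else 0 := by
    intro x y
    have h1 : ∑ z, (if z = (B (Fin.last n)).symm y then (if x = b ∧ y = b then W x z else 0)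
        else W x z) ≤ walkCount R x y := by
      rw [walkCount_succ]
      refine Finset.sum_le_sum fun z _ => ?_
      have h2 : W x z ≤ walkCount (fun t : Fin n => R t.castSucc) x z :=
        walkCount_mono (fun t u v h => hR _ _ _ h) x z
      split_ifs with h3 h4 h5 h6 h7
      · exact h2
      · obtain ⟨rfl, rfl⟩ := h4
        rw [h3, hb, Equiv.symm_apply_apply] at h5
        exact absurd ha h5
      · exact Nat.zero_le _
      · exact le_rfl
      · exact h2
      · refine absurd (hR _ _ _ fun h8 => h3 ?_) h7
        rw [h8, Equiv.symm_apply_apply]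
    have h2 : (∑ z, (if z = (B (Fin.last n)).symm y then (if x = b ∧ y = b then (W x z : ℤ) else 0)
        else W x z)) = (∑ z, (W x z : ℤ)) - W x ((B (Fin.last n)).symm y) +
        if x = b ∧ y = b then (W b a : ℤ) else 0 := by
      have : ∀ z, (if z = (B (Fin.last n)).symm y then (if x = b ∧ y = b then (W x z : ℤ) else 0)
        else W x z) = W x z - (if z = (B (Fin.last n)).symm y then (W x z : ℤ) else 0) +
          if z = (B (Fin.last n)).symm y then (if x = b ∧ y = b then (W x z : ℤ) else 0) else 0 := by
        intro z; split_ifs <;> simp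
      rw [Finset.sum_congr rfl fun z _ => this z, Finset.sum_add_distrib, Finset.sum_sub_distrib]
      simp only [Finset.sum_ite_eq', mem_univ, if_true]
      congr 1
      split_ifs with h
      · obtain ⟨rfl, rfl⟩ := h
        rw [hb, Equiv.symm_apply_apply]
      · rfl
    have h3 : ((∑ z, (if z = (B (Fin.last n)).symm y then (if x = b ∧ y = b then W x z else 0)
        else W x z) : ℕ) : ℤ) ≤ walkCount R x y := by exact_mod_cast h1
    push_cast at h3
    rw [h2] at h3
    have h4 := mul_le_mul_of_nonneg_left h3 (by linarith : (0 : ℤ) ≤ q)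
    rw [mul_add, mul_sub, Finset.mul_sum] at h4
    rw [ge_iff_le]
    refine le_trans (le_of_eq ?_) h4
    congr 1
    split_ifs <;> simp
  have hodd : (-1 : ℤ) ^ n = -1 := hn.neg_one_pow
  have hrow : ∀ x, ∑ z, q * (W x z : ℤ) = q * (q - 1) ^ n := by
    intro x
    rw [Finset.sum_congr rfl fun z _ => hW x z, Finset.sum_add_distrib, ← Finset.mul_sum]
    have : ∀ z : α, (if z = p x then (q - 1 : ℤ) else -1) = (if z = p x then q else 0) - 1 := by
      intro z; split_ifs <;> ring
    rw [Finset.sum_congr rfl fun z _ => this z, Finset.sum_sub_distrib]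
    simp [← hq]
  set f := #{z | (B (Fin.last n)).symm z = p z} with hf
  have hdiag : ∑ x, q * (W x ((B (Fin.last n)).symm x) : ℤ) = q * (q - 1) ^ n - (q * f - q) := by
    rw [Finset.sum_congr rfl fun z _ => hW z _, Finset.sum_add_distrib, ← Finset.mul_sum, hodd]
    have : ∀ z : α, (if (B (Fin.last n)).symm z = p z then (q - 1 : ℤ) else -1) =
        (if (B (Fin.last n)).symm z = p z then q else 0) - 1 := by
      intro z; split_ifs <;> ring
    rw [Finset.sum_congr rfl fun z _ => this z, Finset.sum_sub_distrib, ← Finset.sum_filter]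
    simp [← hq, ← hf]
    ring
  have htotal : q * closedWalkCount R ≥
      q * (q * (q - 1) ^ n) - (q * (q - 1) ^ n - (q * f - q)) + q * W b a := by
    rw [closedWalkCount_eq_sum]
    push_cast
    rw [Finset.mul_sum]
    refine le_trans (le_of_eq ?_) (Finset.sum_le_sum fun x _ => hstep x x)
    rw [Finset.sum_add_distrib, Finset.sum_sub_distrib, hdiag]
    simp only [hrow, and_self, Finset.sum_ite_eq', mem_univ, if_true]
    simp [← hq]
  have hFsub : F ⊆ ({z | (B (Fin.last n)).symm z = p z} : Finset α) := by
    intro z hz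
    simp only [mem_filter, mem_univ, true_and]
    rw [hp z fun t => hF z hz _, Equiv.symm_apply_eq, hF z hz]
  have hgain := hW b a
  rw [hodd] at hgain
  rw [pow_succ]
  -- Both cases give the same bound. If `p b = a`, then `W b a` is smaller by 1, but `b` is a
  -- further fixed point outside `F`.
  split_ifs at hgain with h
  · have h1 : #F + 1 ≤ f := by
      rw [← Finset.card_insert_of_notMem haF]
      refine Finset.card_le_card (Finset.insert_subset ?_ hFsub)
      simp only [mem_filter, mem_univ, true_and]
      rw [← h, hb, Equiv.symm_apply_apply]
    have h2 : ((#F : ℤ) + 1) ≤ f := by exact_mod_cast h1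
    nlinarith
  · have h1 : ((#F : ℤ)) ≤ f := by exact_mod_cast Finset.card_le_card hFsub
    nlinarith

end Walks

/-! ### Twisted cycles with one color forbidden -/

section Twist

variable {m n : ℕ}

/-- The number of colorings of a cycle of length `n + 1`, with monodromy given by the permutations
`σ t`, that avoid the color `j`. -/
noncomputable def twistCount (σ : Fin (n + 1) → Equiv.Perm (Fin m)) (j : Fin m) : ℕ :=
  closedWalkCount (α := {x : Fin m // x ≠ j}) fun t a b => b.1 ≠ σ t a.1

/-- The colors moved by one of the permutations. -/
def movedColors (σ : Fin n → Equiv.Perm (Fin m)) : Finset (Fin m) :=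
  {i | ∃ t, σ t i ≠ i}

theorem exists_perm_avoiding (s : Equiv.Perm (Fin m)) (j : Fin m) :
    ∃ B : Equiv.Perm {x : Fin m // x ≠ j},
      (∀ x y, y ≠ B x → y.1 ≠ s x.1) ∧ (∀ z : {x : Fin m // x ≠ j}, s z.1 = z.1 → B z = z) ∧
      (s j ≠ j → ∃ a, (B a).1 = s j ∧ (B a).1 ≠ s a.1) := by
  have hj : (Equiv.swap j (s j) * s) j = j := by
    rw [Equiv.Perm.mul_apply, Equiv.swap_apply_right]
  -- Bypass `j`: the color that `s` sends to `j` is sent to `s j` instead. This is the only pair of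
  -- `B` that is not a pair of `s`.
  refine ⟨(Equiv.swap j (s j) * s).subtypePerm (p := fun x => x ≠ j) fun x => ?_, ?_, ?_, ?_⟩
  · rw [not_iff_not]
    constructor
    · intro h
      exact (Equiv.swap j (s j) * s).injective (h.trans hj.symm)
    · rintro rfl
      exact hj
  · rintro ⟨x, hx⟩ ⟨y, hy⟩ h h'
    apply h
    apply Subtype.ext
    simp only [Equiv.Perm.subtypePerm_apply, Equiv.Perm.mul_apply] at h' ⊢
    rw [← h', Equiv.swap_apply_of_ne_of_ne hy]
    rw [h']
    exact fun h => hx (s.injective h)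
  · rintro ⟨z, hz⟩ h
    apply Subtype.ext
    simp only [Equiv.Perm.subtypePerm_apply, Equiv.Perm.mul_apply] at h ⊢
    rw [h, Equiv.swap_apply_of_ne_of_ne hz]
    exact fun h' => hz (s.injective (h.trans h'))
  · intro h
    refine ⟨⟨s.symm j, fun h' => h ?_⟩, ?_, ?_⟩
    · conv_lhs => rw [← h']
      exact s.apply_symm_apply j
    · simp
    · simpa using h

theorem card_colors_ne (j : Fin m) : Fintype.card {x : Fin m // x ≠ j} = m - 1 := by
  simp

theorem nonempty_colors_ne (hm : 2 ≤ m) (j : Fin m) : Nonempty {x : Fin m // x ≠ j} := by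
  rw [← Fintype.card_pos_iff, card_colors_ne]
  omega

theorem twistCount_one (hm : 2 ≤ m) (j : Fin m) :
    (twistCount (fun _ : Fin (n + 1) => (1 : Equiv.Perm (Fin m))) j : ℤ) =
      (m - 2) ^ (n + 1) + (-1) ^ (n + 1) * (m - 2) := by
  have := nonempty_colors_ne hm j
  obtain ⟨f, hf, hf', h⟩ := closedWalkCount_perm
    fun _ : Fin (n + 1) => (1 : Equiv.Perm {x : Fin m // x ≠ j})
  have hff := hf univ fun _ _ _ => rfl
  rw [Finset.card_univ] at hff
  have hf2 : (f : ℤ) = m - 1 := by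
    rw [card_colors_ne] at hff hf'
    omega
  have h1 : (twistCount (fun _ : Fin (n + 1) => (1 : Equiv.Perm (Fin m))) j) =
      closedWalkCount fun (t : Fin (n + 1)) a b =>
        b ≠ (fun _ => (1 : Equiv.Perm {x : Fin m // x ≠ j})) t a := by
    unfold twistCount
    simp [Subtype.ext_iff]
  rw [h1, h, hf2, card_colors_ne]
  push_cast [show 1 ≤ m by omega]
  ring

/-- Avoiding the extended permutations is a stronger condition than avoiding `σ`. The upper bound on
the fixed points `f` serves odd cycles and the lower bound serves even ones, according to the sign
of `f`. -/
theorem exists_le_twistCount (hm : 2 ≤ m) (σ : Fin (n + 1) → Equiv.Perm (Fin m)) (j : Fin m) :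
    ∃ f : ℕ, #((movedColors σ)ᶜ.erase j) ≤ f ∧ f ≤ m - 1 ∧
      ((m - 2) ^ (n + 1) + (-1) ^ (n + 1) * (f - 1) : ℤ) ≤ twistCount σ j := by
  have := nonempty_colors_ne hm j
  choose B hB1 hB2 hB3 using fun t => exists_perm_avoiding (σ t) j
  obtain ⟨f, hf, hf', h⟩ := closedWalkCount_perm B
  refine ⟨f, ?_, by rwa [card_colors_ne] at hf', ?_⟩
  · have := hf ((movedColors σ)ᶜ.subtype fun x => x ≠ j) (by
      intro z hz t
      apply hB2
      simp only [movedColors, mem_subtype, mem_compl, mem_filter, mem_univ, true_and, not_exists,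
        not_not] at hz
      exact hz t)
    rwa [Finset.card_subtype, Finset.filter_ne'] at this
  · have h2 : closedWalkCount (fun t a b => b ≠ B t a) ≤ twistCount σ j :=
      closedWalkCount_mono fun t x y => hB1 t x y
    rw [card_colors_ne] at h
    push_cast [show 1 ≤ m by omega] at h
    have h3 : (closedWalkCount (fun t a b => b ≠ B t a) : ℤ) ≤ twistCount σ j := by
      exact_mod_cast h2
    rw [h] at h3
    refine le_trans (le_of_eq ?_) h3
    ring

theorem le_twistCount_of_even (hm : 2 ≤ m) (hn : Even n) (σ : Fin (n + 1) → Equiv.Perm (Fin m))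
    (j : Fin m) : ((m - 2) ^ (n + 1) - (m - 2) : ℤ) ≤ twistCount σ j := by
  obtain ⟨f, -, hf, h⟩ := exists_le_twistCount hm σ j
  rw [hn.add_one.neg_one_pow] at h
  have : (f : ℤ) ≤ m - 1 := by omega
  linarith

theorem le_twistCount_of_odd (hm : 2 ≤ m) (hn : Odd n) (σ : Fin (n + 1) → Equiv.Perm (Fin m))
    {j : Fin m} (hj : j ∉ movedColors σ) :
    ((m - 2) ^ (n + 1) + (m - 2) - #(movedColors σ) : ℤ) ≤ twistCount σ j := by
  obtain ⟨f, hf, -, h⟩ := exists_le_twistCount hm σ j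
  rw [hn.add_one.neg_one_pow] at h
  rw [Finset.card_erase_of_mem (by simpa using hj), Finset.card_compl, Fintype.card_fin] at hf
  have : (m - #(movedColors σ) - 1 : ℤ) ≤ f := by omega
  linarith

theorem le_twistCount_of_mem (hm : 2 ≤ m) (hn : Odd n) (σ : Fin (n + 1) → Equiv.Perm (Fin m))
    {j : Fin m} (hj : j ∈ movedColors σ) :
    ((m - 1) * ((m - 2) ^ (n + 1) + (m - #(movedColors σ)) - 1) + (m - 2) ^ n + 1 : ℤ) ≤
      (m - 1) * twistCount σ j := by
  have := nonempty_colors_ne hm j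
  obtain ⟨s, hs⟩ : ∃ s, σ s j ≠ j := by simpa [movedColors] using hj
  -- Rotate the cycle so that the step `s` moving `j` becomes the last one, where the extra pair is
  -- admitted.
  choose B hB1 hB2 hB3 using fun t => exists_perm_avoiding (σ (t + (s + 1))) j
  have hlast : Fin.last n + (s + 1) = s := by
    rw [add_comm s, ← add_assoc, Fin.last_add_one, zero_add]
  obtain ⟨a, ha1, ha2⟩ := hB3 (Fin.last n) (by rwa [hlast])
  rw [hlast] at ha1
  have key := le_closedWalkCount_of_extra hn B (fun t x y => y.1 ≠ σ (t + (s + 1)) x.1) hB1 a ha2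
    ((movedColors σ)ᶜ.subtype fun x => x ≠ j) (by
      intro z hz t
      apply hB2
      simp only [movedColors, mem_subtype, mem_compl, mem_filter, mem_univ, true_and, not_exists,
        not_not] at hz
      exact hz _) (by
      simp only [movedColors, mem_subtype, mem_compl, mem_filter, mem_univ, true_and, not_exists,
        not_not, ha1]
      exact fun h => hs ((σ s).injective (h s)))
  rw [closedWalkCount_rotate (fun t (x y : {x : Fin m // x ≠ j}) => y.1 ≠ σ t x.1) (s + 1),
    Finset.card_subtype, Finset.filter_ne', Finset.erase_eq_of_notMem (by simpa using hj),
    card_colors_ne, Finset.card_compl, Fintype.card_fin] at key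
  have hle : #(movedColors σ) ≤ m := by simpa using Finset.card_le_univ (movedColors σ)
  push_cast [show 1 ≤ m by omega, hle] at key
  unfold twistCount
  refine le_trans (le_of_eq ?_) key
  ring

end Twist

/-! ### Decoupling the cycles and numerical estimates -/

section Inequalities

/-- The logarithm turns the product into a sum over `i`, so a condition on all factors jointly
reduces to one condition per factor: `∏ x ≥ 1 + ∑ log x ≥ 1 + ∑ (1 - 1/x)`. -/
theorem sum_le_sum_mul_prod {ι C : Type*} [Fintype C] (S : Finset ι) (w : C → ℝ) (x : ι → C → ℝ)
    (hw : ∀ j, 0 ≤ w j) (hx : ∀ i ∈ S, ∀ j, 0 < x i j)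
    (h : ∀ i ∈ S, 0 ≤ ∑ j, w j * (1 - (x i j)⁻¹)) :
    ∑ j, w j ≤ ∑ j, w j * ∏ i ∈ S, x i j := by
  have h1 : ∀ j, w j + ∑ i ∈ S, w j * (1 - (x i j)⁻¹) ≤ w j * ∏ i ∈ S, x i j := by
    intro j
    rw [← Finset.mul_sum]
    have hpos : 0 < ∏ i ∈ S, x i j := Finset.prod_pos fun i hi => hx i hi j
    have h2 : ∑ i ∈ S, (1 - (x i j)⁻¹) ≤ Real.log (∏ i ∈ S, x i j) := by
      rw [Real.log_prod fun i hi => (hx i hi j).ne']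
      exact Finset.sum_le_sum fun i hi => Real.one_sub_inv_le_log_of_pos (hx i hi j)
    have h3 := Real.log_le_sub_one_of_pos hpos
    nlinarith [hw j]
  have h2 := Finset.sum_le_sum fun j (_ : j ∈ univ) => h1 j
  rw [Finset.sum_add_distrib, Finset.sum_comm] at h2
  have h3 := Finset.sum_nonneg h
  linarith

/-- Colors in `D` contribute at least `lo * (G - #D) / (P - #D + G)` each, the others at least `-hi
* #D / (P - #D)`. The total has a factor `#D`, and `key` is what remains after clearing
denominators. -/
theorem sum_mul_one_sub_div_nonneg {C : Type*} [Fintype C] [DecidableEq C] (D : Finset C)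
    (w N : C → ℝ) (P G lo hi : ℝ) (hlo0 : 0 ≤ lo) (hlo : ∀ j, lo ≤ w j) (hhi : ∀ j, w j ≤ hi)
    (hP : (#D : ℝ) < P) (hG : (#D : ℝ) ≤ G) (hN : ∀ j ∉ D, P - #D ≤ N j)
    (hN' : ∀ j ∈ D, P - #D + G ≤ N j)
    (key : hi * (Fintype.card C - #D) * (P - #D + G) ≤ lo * (G - #D) * (P - #D)) :
    0 ≤ ∑ j, w j * (1 - P / N j) := by
  have he0 : (0 : ℝ) ≤ #D := Nat.cast_nonneg _
  have hb : 0 < P - #D := by linarith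
  have hb' : 0 < P - #D + G := by linarith
  have h1 : ∀ j ∈ D, lo * ((G - #D) / (P - #D + G)) ≤ w j * (1 - P / N j) := by
    intro j hj
    have h2 : (G - #D) / (P - #D + G) ≤ 1 - P / N j := by
      have : P / N j ≤ P / (P - #D + G) :=
        div_le_div_of_nonneg_left (by linarith) hb' (hN' j hj)
      have h3 : (G - #D) / (P - #D + G) = 1 - P / (P - #D + G) := by
        field_simp; ring
      linarith
    have h3 : 0 ≤ (G - #D) / (P - #D + G) := div_nonneg (by linarith) hb'.le
    exact mul_le_mul (hlo j) h2 h3 (hlo0.trans (hlo j))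
  have h2 : ∀ j ∈ Dᶜ, -(hi * (#D / (P - #D))) ≤ w j * (1 - P / N j) := by
    intro j hj
    have h2 : -(#D / (P - #D)) ≤ 1 - P / N j := by
      have : P / N j ≤ P / (P - #D) :=
        div_le_div_of_nonneg_left (by linarith) hb (hN j (by simpa using hj))
      have h3 : -(#D / (P - #D)) = 1 - P / (P - #D) := by
        field_simp; ring
      linarith
    have h3 : 0 ≤ #D / (P - #D) := div_nonneg he0 hb.le
    have h4 := hlo j
    have h5 := hhi j
    nlinarith
  have h3 := Finset.sum_le_sum h1
  have h4 := Finset.sum_le_sum h2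
  rw [Finset.sum_const, nsmul_eq_mul] at h3 h4
  rw [← Finset.sum_add_sum_compl D]
  refine le_trans ?_ (add_le_add h3 h4)
  rw [Finset.card_compl, Nat.cast_sub (Finset.card_le_univ D)]
  have : (#D : ℝ) * (lo * ((G - #D) / (P - #D + G))) +
      (Fintype.card C - #D) * -(hi * (#D / (P - #D))) =
      #D * (lo * (G - #D) * (P - #D) - hi * (Fintype.card C - #D) * (P - #D + G)) /
        ((P - #D + G) * (P - #D)) := by
    field_simp
    ring
  rw [this]
  apply div_nonneg (mul_nonneg he0 (by linarith)) (by positivity)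

/-- The number of proper colorings of a cycle of length `n + 1` with `m - 1` colors. -/
noncomputable def cycleValue (m n : ℕ) : ℝ :=
  ((m : ℝ) - 2) ^ (n + 1) + (-1) ^ (n + 1) * ((m : ℝ) - 2)

theorem cycleValue_pos {m n : ℕ} (hm : 4 ≤ m) (hn : 2 ≤ n) : 0 < cycleValue m n := by
  have hr : (2 : ℝ) ≤ (m : ℝ) - 2 := by
    have : (4 : ℝ) ≤ m := by exact_mod_cast hm
    linarith
  have h1 : ((m : ℝ) - 2) ^ 2 ≤ ((m : ℝ) - 2) ^ (n + 1) := pow_le_pow_right₀ (by linarith) (by omega)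
  unfold cycleValue
  rcases neg_one_pow_eq_or ℝ (n + 1) with h | h <;> rw [h] <;> nlinarith

variable {m n : ℕ}

theorem cycleValue_le_of_even (hm : 2 ≤ m) (hn : Even n) (σ : Fin (n + 1) → Equiv.Perm (Fin m))
    (j : Fin m) : cycleValue m n ≤ twistCount σ j := by
  have h : (((m - 2) ^ (n + 1) - (m - 2) : ℤ) : ℝ) ≤ ((twistCount σ j : ℤ) : ℝ) :=
    Int.cast_le.2 (le_twistCount_of_even hm hn σ j)
  push_cast at h
  unfold cycleValue
  rw [hn.add_one.neg_one_pow]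
  linarith

theorem cycleValue_le_of_notMem (hm : 2 ≤ m) (hn : Odd n) (σ : Fin (n + 1) → Equiv.Perm (Fin m))
    {j : Fin m} (hj : j ∉ movedColors σ) :
    cycleValue m n - #(movedColors σ) ≤ twistCount σ j := by
  have h : (((m - 2) ^ (n + 1) + (m - 2) - #(movedColors σ) : ℤ) : ℝ) ≤
    ((twistCount σ j : ℤ) : ℝ) := Int.cast_le.2 (le_twistCount_of_odd hm hn σ hj)
  push_cast at h
  unfold cycleValue
  rw [hn.add_one.neg_one_pow]
  linarith

/-- The gain for a color moved by one of the permutations. -/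
noncomputable def twistGain (m n : ℕ) : ℝ :=
  (((m : ℝ) - 2) ^ n + 1) / (m - 1) + 1

theorem cycleValue_le_of_mem (hm : 2 ≤ m) (hn : Odd n) (σ : Fin (n + 1) → Equiv.Perm (Fin m))
    {j : Fin m} (hj : j ∈ movedColors σ) :
    cycleValue m n - #(movedColors σ) + twistGain m n ≤ twistCount σ j := by
  have h : (((m - 1) * ((m - 2) ^ (n + 1) + (m - #(movedColors σ)) - 1) + (m - 2) ^ n + 1 : ℤ) : ℝ) ≤
    (((m - 1) * twistCount σ j : ℤ) : ℝ) := Int.cast_le.2 (le_twistCount_of_mem hm hn σ hj)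
  push_cast at h
  have hm1 : (0 : ℝ) < m - 1 := by
    have : (2 : ℝ) ≤ m := by exact_mod_cast hm
    linarith
  rw [← mul_le_mul_iff_right₀ hm1]
  refine le_trans (le_of_eq ?_) h
  unfold cycleValue twistGain
  rw [hn.add_one.neg_one_pow]
  field_simp
  ring

theorem twistCount_pos (hm : 4 ≤ m) (hn : 2 ≤ n) (σ : Fin (n + 1) → Equiv.Perm (Fin m))
    (j : Fin m) : (0 : ℝ) < twistCount σ j := by
  obtain ⟨f, -, hf, h⟩ := exists_le_twistCount (by omega) σ j
  have h1 : (2 : ℤ) ≤ m - 2 := by omega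
  have h2 : ((m : ℤ) - 2) ^ 3 ≤ (m - 2) ^ (n + 1) := pow_le_pow_right₀ (by linarith) (by omega)
  have h3 : (f : ℤ) ≤ m - 2 + 1 := by omega
  have h0 : (0 : ℤ) ≤ f := Int.natCast_nonneg f
  have h4 : (0 : ℤ) < twistCount σ j := by
    generalize (m : ℤ) - 2 = r at *
    have h5 : 4 * r ≤ r ^ 3 := by nlinarith [mul_nonneg (by linarith : 0 ≤ r) (by linarith : 0 ≤ r - 2)]
    rcases neg_one_pow_eq_or ℤ (n + 1) with h' | h' <;> rw [h'] at h <;> nlinarith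
  exact_mod_cast h4

theorem sum_one_sub_div_twistCount_nonneg (hm : 4 ≤ m) (hn : 2 ≤ n) (hmn : m = 4 → n ≠ 3)
    (σ : Fin (n + 1) → Equiv.Perm (Fin m)) (w : Fin m → ℝ)
    (hw : (∀ j, w j = 1) ∧ 5 ≤ m ∨ m = 4 ∧ ∀ j, 14 ≤ w j ∧ w j ≤ 22) :
    0 ≤ ∑ j, w j * (1 - cycleValue m n / twistCount σ j) := by
  rcases Nat.even_or_odd n with hn' | hn'
  -- The cycle length `n + 1` is odd, so every single term is nonnegative.
  · refine Finset.sum_nonneg fun j _ => mul_nonneg ?_ ?_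
    · rcases hw with ⟨h, -⟩ | ⟨-, h⟩
      · rw [h]; exact zero_le_one
      · linarith [(h j).1]
    · rw [sub_nonneg, div_le_one (twistCount_pos hm hn σ j)]
      exact cycleValue_le_of_even (by omega) hn' σ j
  have hD : #(movedColors σ) ≤ m := by simpa using Finset.card_le_univ (movedColors σ)
  have hN := fun j (hj : j ∉ movedColors σ) => cycleValue_le_of_notMem (by omega) hn' σ hj
  have hN' := fun j (hj : j ∈ movedColors σ) => cycleValue_le_of_mem (by omega) hn' σ hj
  have hn3 : 3 ≤ n := by
    rcases hn' with ⟨s, rfl⟩; omega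
  rcases hw with ⟨hw, hm5⟩ | ⟨rfl, hw⟩
  · obtain ⟨r, hr⟩ : ∃ r : ℝ, r = (m : ℝ) - 2 := ⟨_, rfl⟩
    have hr3 : 3 ≤ r := by
      have : (5 : ℝ) ≤ m := by exact_mod_cast hm5
      linarith
    have hmr : (m : ℝ) = r + 2 := by linarith
    have hT : r ^ 3 ≤ r ^ n := pow_le_pow_right₀ (by linarith) hn3
    have hT2 : 3 * r ^ 2 ≤ r ^ 3 := by nlinarith [sq_nonneg r]
    have hP : r ^ 2 + 5 * r + 6 ≤ cycleValue m n := by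
      unfold cycleValue
      rw [hn'.add_one.neg_one_pow, ← hr, pow_succ r n]
      nlinarith
    have hG : r + 3 ≤ twistGain m n := by
      unfold twistGain
      rw [← hr, hmr]
      have : r + 2 ≤ (r ^ n + 1) / (r + 2 - 1) := by
        rw [le_div_iff₀ (by linarith)]
        nlinarith
      linarith
    have hDr : (#(movedColors σ) : ℝ) ≤ r + 2 := by rw [← hmr]; exact_mod_cast hD
    refine sum_mul_one_sub_div_nonneg (movedColors σ) w _ (cycleValue m n) (twistGain m n) 1 1
      zero_le_one (fun j => (hw j).ge) (fun j => (hw j).le) (by nlinarith) (by linarith) hN hN' ?_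
    rw [Fintype.card_fin, hmr]
    have h1 : 0 ≤ (#(movedColors σ) : ℝ) := Nat.cast_nonneg _
    -- With `s = r + 2 - e` and `u = G - (r + 2) ≥ 1`, the inequality reduces to `s * (r + 2) ≤ u *
    -- (P - (r + 2))`, and `s ≤ r + 2`.
    nlinarith [mul_le_mul (show (1 : ℝ) ≤ twistGain m n - (r + 2) by linarith)
      (show (r + 2) ^ 2 ≤ cycleValue m n - (r + 2) by nlinarith) (by positivity) (by linarith)]
  · have hn5 : 5 ≤ n := by
      have := hmn rfl
      rcases hn' with ⟨s, rfl⟩; omega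
    have hT : (2 : ℝ) ^ 5 ≤ 2 ^ n := pow_le_pow_right₀ (by norm_num) hn5
    have hP : cycleValue 4 n = 2 * 2 ^ n + 2 := by
      unfold cycleValue
      rw [hn'.add_one.neg_one_pow, pow_succ]
      push_cast
      norm_num
      ring
    have hG : twistGain 4 n = (2 ^ n + 4) / 3 := by
      unfold twistGain
      push_cast
      norm_num
      ring
    have hDr : (#(movedColors σ) : ℝ) ≤ 4 := by exact_mod_cast hD
    refine sum_mul_one_sub_div_nonneg (movedColors σ) w _ (cycleValue 4 n) (twistGain 4 n) 14 22
      (by norm_num) (fun j => (hw j).1) (fun j => (hw j).2) (by rw [hP]; linarith)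
      (by rw [hG]; linarith) hN hN' ?_
    rw [Fintype.card_fin, hP, hG]
    generalize #(movedColors σ) = e at *
    generalize (2 : ℝ) ^ n = T at *
    interval_cases e <;> push_cast <;> nlinarith

/-- For a 4-cycle with 4 colors `P = 18` and `G = 4`, so the lower bounds are `18 - e`, plus 4 on
the `e` moved colors. As `G` equals the number of colors, they sum to exactly `4 * 18`; as `e ≤ 4`,
they lie in `[14, 22]`. -/
theorem exists_weights (σ : Fin (3 + 1) → Equiv.Perm (Fin 4)) :
    ∃ w : Fin 4 → ℝ, (∀ j, 14 ≤ w j ∧ w j ≤ 22) ∧ (∀ j, w j ≤ twistCount σ j) ∧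
      ∑ j, w j = 4 * cycleValue 4 3 := by
  have hD : #(movedColors σ) ≤ 4 := by simpa using Finset.card_le_univ (movedColors σ)
  have hDr : (#(movedColors σ) : ℝ) ≤ 4 := by exact_mod_cast hD
  have hD0 : (0 : ℝ) ≤ #(movedColors σ) := Nat.cast_nonneg _
  have hP : cycleValue 4 3 = 18 := by unfold cycleValue; norm_num
  have hG : twistGain 4 3 = 4 := by unfold twistGain; norm_num
  refine ⟨fun j => 18 - #(movedColors σ) + if j ∈ movedColors σ then 4 else 0, fun j => ?_,
    fun j => ?_, ?_⟩
  · dsimp only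
    split_ifs <;> constructor <;> linarith
  · dsimp only
    split_ifs with h
    · have := cycleValue_le_of_mem (by norm_num) (by decide) σ h
      rwa [hP, hG] at this
    · have := cycleValue_le_of_notMem (by norm_num) (by decide) σ h
      rw [hP] at this
      linarith
  · rw [Finset.sum_add_distrib, Finset.sum_ite_mem]
    simp [hP]
    ring

/-- Summed over the color of the apex, the colorings of a cone over cycles are at least as many
with twisted cycles as without. -/
theorem mul_prod_cycleValue_le {ι : Type*} [Fintype ι] (n : ι → ℕ) (hm : 4 ≤ m)
    (hn : ∀ i, 2 ≤ n i) (hfour : ∀ p q, n p = 3 → n q = 3 → p = q)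
    (σ : ∀ i, Fin (n i + 1) → Equiv.Perm (Fin m)) :
    m * ∏ i, cycleValue m (n i) ≤ ∑ j, ∏ i, (twistCount (σ i) j : ℝ) := by
  classical
  have hmain : ∀ (S : Finset ι) (w : Fin m → ℝ), (∀ i ∈ S, m = 4 → n i ≠ 3) →
      ((∀ j, w j = 1) ∧ 5 ≤ m ∨ m = 4 ∧ ∀ j, 14 ≤ w j ∧ w j ≤ 22) →
      (∑ j, w j) * ∏ i ∈ S, cycleValue m (n i) ≤ ∑ j, w j * ∏ i ∈ S, (twistCount (σ i) j : ℝ) := by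
    intro S w hS hw
    have h := sum_le_sum_mul_prod S w (fun i j => twistCount (σ i) j / cycleValue m (n i))
      (fun j => by
        rcases hw with ⟨h, -⟩ | ⟨-, h⟩
        · rw [h]; exact zero_le_one
        · linarith [(h j).1])
      (fun i _ j => div_pos (twistCount_pos hm (hn i) _ j) (cycleValue_pos hm (hn i)))
      (fun i hi => by
        simp only [inv_div]
        exact sum_one_sub_div_twistCount_nonneg hm (hn i) (hS i hi) (σ i) w hw)
    have hpos : 0 < ∏ i ∈ S, cycleValue m (n i) :=
      Finset.prod_pos fun i _ => cycleValue_pos hm (hn i)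
    refine (mul_le_mul_of_nonneg_right h hpos.le).trans (le_of_eq ?_)
    rw [Finset.sum_mul]
    refine Finset.sum_congr rfl fun j _ => ?_
    rw [Finset.prod_div_distrib, mul_assoc, div_mul_cancel₀ _ hpos.ne']
  by_cases h : m = 4 ∧ ∃ p, n p = 3
  · obtain ⟨rfl, p, hp⟩ := h
    obtain ⟨w, hw1, hw2, hw3⟩ : ∃ w : Fin 4 → ℝ, (∀ j, 14 ≤ w j ∧ w j ≤ 22) ∧
        (∀ j, w j ≤ twistCount (σ p) j) ∧ ∑ j, w j = 4 * cycleValue 4 (n p) := by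
      generalize σ p = τ
      generalize n p = a at *
      subst hp
      exact exists_weights τ
    -- The unique 4-cycle `p` enters only through the weights; every other cycle meets the per-cycle
    -- criterion.
    have h1 := hmain (univ.erase p) w (fun i hi _ hi3 => (Finset.mem_erase.1 hi).1
      (hfour i p hi3 hp)) (Or.inr ⟨rfl, hw1⟩)
    rw [hw3, mul_assoc, Finset.mul_prod_erase univ (fun i => cycleValue 4 (n i)) (mem_univ p)] at h1
    refine (le_of_eq (by norm_num)).trans (h1.trans (Finset.sum_le_sum fun j _ => ?_))
    rw [← Finset.mul_prod_erase univ _ (mem_univ p)]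
    exact mul_le_mul_of_nonneg_right (hw2 j) (Finset.prod_nonneg fun _ _ => Nat.cast_nonneg _)
  · have hS : ∀ i ∈ (univ : Finset ι), m = 4 → n i ≠ 3 := fun i _ h4 h3 => h ⟨h4, i, h3⟩
    rcases hm.lt_or_eq with h5 | h4
    · simpa using hmain univ (fun _ => 1) hS (Or.inl ⟨fun _ => rfl, h5⟩)
    -- Any constant in `[14, 22]` would do, since it cancels.
    · have := hmain univ (fun _ => 18) hS (Or.inr ⟨h4.symm, fun _ => by norm_num⟩)
      rw [← Finset.mul_sum, Finset.sum_const, nsmul_eq_mul, Finset.card_univ, Fintype.card_fin] at this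
      linarith

end Inequalities

/-! ### Covers of the cone and their normal form -/

theorem exists_equiv_of_matching {W : Type*} [Finite W] {A B : Set W} {m : ℕ} (e : Fin m ≃ A)
    (hB : B.ncard = m) (r : W → W → Prop)
    (h : ∀ a ∈ A, ∀ b ∈ B, ∀ c ∈ B, r a b → r a c → b = c)
    (h' : ∀ a ∈ A, ∀ c ∈ A, ∀ b ∈ B, r a b → r c b → a = c) :
    ∃ g : Fin m ≃ B, ∀ i, ∀ b ∈ B, r (e i) b → (g i : W) = b := by
  classical
  have := Fintype.ofFinite W
  -- The default `e i` is irrelevant: the bijection has to extend `f` only from the indices that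
  -- have a partner.
  let f : Fin m → W := fun i => if h : ∃ b ∈ B, r (e i) b then h.choose else e i
  have hf : ∀ i, (∃ b ∈ B, r (e i) b) → f i ∈ B ∧ r (e i) (f i) := by
    intro i hi
    simp only [f, dif_pos hi]
    exact hi.choose_spec
  obtain ⟨g, hg⟩ := Set.MapsTo.exists_equiv_extend_of_card_eq (t := B.toFinset)
    (s := {i | ∃ b ∈ B, r (e i) b}) (f := f)
    (by rw [Fintype.card_fin, ← hB, Set.ncard_eq_toFinset_card'])
    (fun i hi => by simpa using (hf i hi).1)
    (fun i hi j hj hij => by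
      apply e.injective
      apply Subtype.ext
      refine h' _ (e i).2 _ (e j).2 _ (hf i hi).1 (hf i hi).2 ?_
      rw [hij]
      exact (hf j hj).2)
  refine ⟨g.trans (Equiv.subtypeEquivRight fun x => by simp), fun i b hb hr => ?_⟩
  have hi : ∃ b ∈ B, r (e i) b := ⟨b, hb, hr⟩
  rw [← h _ (e i).2 _ (hf i hi).1 _ hb (hf i hi).2 hr, ← hg i hi]
  rfl

theorem IsCover.eq_of_mem {V W : Type*} {G : SimpleGraph V} {H : SimpleGraph W} {L : V → Set W}
    (hc : IsCover G H L) {u v : V} {a : W} (hu : a ∈ L u) (hv : a ∈ L v) : u = v :=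
  hc.injective ((hc.isPartition.2 a).unique ⟨⟨u, rfl⟩, hu⟩ ⟨⟨v, rfl⟩, hv⟩)

section Cone

variable {ι : Type*} (k : ι → ℕ)

/-- The cone over the disjoint union of the cycles of lengths `k i + 3`. -/
abbrev coneOfCycles : SimpleGraph (Unit ⊕ Σ i, Fin (k i + 3)) :=
  cone (disjointUnion fun i => SimpleGraph.cycleGraph (k i + 3))

/-- The edges of the cone over cycles, oriented away from the apex and along the cycles. -/
def Arc (u v : Unit ⊕ Σ i, Fin (k i + 3)) : Prop :=
  (∃ x, u = Sum.inl () ∧ v = Sum.inr x) ∨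
    ∃ i t, u = Sum.inr ⟨i, t⟩ ∧ v = Sum.inr ⟨i, t + 1⟩

variable {k}

theorem coneOfCycles_adj {u v : Unit ⊕ Σ i, Fin (k i + 3)} :
    (coneOfCycles k).Adj u v ↔ Arc k u v ∨ Arc k v u := by
  rcases u with ⟨⟩ | u <;> rcases v with ⟨⟩ | v
  · simp [Arc]
  · simp [Arc, coneOfCycles, cone, join]
  · simp [Arc, coneOfCycles, cone, join]
  · have h : (coneOfCycles k).Adj (Sum.inr u) (Sum.inr v) ↔
        (disjointUnion fun i => SimpleGraph.cycleGraph (k i + 3)).Adj u v := by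
      simp [coneOfCycles, cone, join]
    rw [h]
    clear h
    simp only [disjointUnion, SimpleGraph.iSup_adj, SimpleGraph.map_adj,
      Function.Embedding.sigmaMk_apply, SimpleGraph.cycleGraph_adj, Arc, reduceCtorEq, false_and,
      exists_false, false_or, Sum.inr.injEq, sub_eq_iff_eq_add]
    constructor
    · rintro ⟨i, s, t, h | h, rfl, rfl⟩
      · exact Or.inr ⟨i, t, rfl, by rw [h, add_comm]⟩
      · exact Or.inl ⟨i, s, rfl, by rw [h, add_comm]⟩
    · rintro (⟨i, t, rfl, rfl⟩ | ⟨i, t, rfl, rfl⟩)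
      · exact ⟨i, t, t + 1, Or.inr (add_comm _ _), rfl, rfl⟩
      · exact ⟨i, t + 1, t, Or.inl (add_comm _ _), rfl, rfl⟩

/-- The colorings of the cone over cycles from the cover given by the identity along the spokes and
the permutations `σ i t` along the rims. -/
def IsTwistedColoring {m : ℕ} (σ : ∀ i, Fin (k i + 3) → Equiv.Perm (Fin m))
    (c : (Unit ⊕ Σ i, Fin (k i + 3)) → Fin m) : Prop :=
  (∀ x, c (Sum.inr x) ≠ c (Sum.inl ())) ∧
    ∀ i t, c (Sum.inr ⟨i, t + 1⟩) ≠ σ i t (c (Sum.inr ⟨i, t⟩))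

/-- A twisted coloring consists of a color for the apex and of closed walks avoiding it. -/
def twistedColoringEquiv {m : ℕ} (σ : ∀ i, Fin (k i + 3) → Equiv.Perm (Fin m)) :
    {c // IsTwistedColoring σ c} ≃ Σ j : Fin m, ∀ i,
      {d : Fin (k i + 3) → {x : Fin m // x ≠ j} // ∀ t, (d (t + 1)).1 ≠ σ i t (d t).1} where
  toFun c := ⟨c.1 (Sum.inl ()), fun i => ⟨fun t => ⟨c.1 (Sum.inr ⟨i, t⟩), c.2.1 _⟩, c.2.2 i⟩⟩
  invFun d := ⟨Sum.elim (fun _ => d.1) fun x => ((d.2 x.1).1 x.2).1,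
    fun x => ((d.2 x.1).1 x.2).2, fun i => (d.2 i).2⟩
  left_inv c := by
    apply Subtype.ext
    funext v
    rcases v with ⟨⟩ | v <;> rfl
  right_inv d := rfl

theorem card_isTwistedColoring [Fintype ι] {m : ℕ}
    (σ : ∀ i, Fin (k i + 3) → Equiv.Perm (Fin m)) :
    Nat.card {c // IsTwistedColoring σ c} = ∑ j, ∏ i, twistCount (n := k i + 2) (σ i) j := by
  rw [Nat.card_congr (twistedColoringEquiv σ), Nat.card_sigma]
  simp only [Nat.card_pi]
  rfl

theorem chromaticCount_coneOfCycles [Fintype ι] (m : ℕ) :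
    chromaticCount (coneOfCycles k) m =
      ∑ j : Fin m, ∏ i, twistCount (n := k i + 2) (fun _ => (1 : Equiv.Perm (Fin m))) j := by
  rw [← card_isTwistedColoring fun i _ => 1]
  refine Nat.card_congr ⟨fun c => ⟨c, fun x => ?_, fun i t => ?_⟩,
    fun c => SimpleGraph.Coloring.mk c.1 ?_, fun c => ?_, fun c => rfl⟩
  · exact c.valid (coneOfCycles_adj.2 (Or.inr (Or.inl ⟨x, rfl, rfl⟩)))
  · exact c.valid (coneOfCycles_adj.2 (Or.inr (Or.inr ⟨i, t, rfl, rfl⟩)))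
  · have h : ∀ {u v}, Arc k u v → c.1 u ≠ c.1 v := by
      rintro u v (⟨x, rfl, rfl⟩ | ⟨i, t, rfl, rfl⟩)
      · exact (c.2.1 x).symm
      · exact (c.2.2 i t).symm
    intro u v huv
    rcases coneOfCycles_adj.1 huv with h' | h'
    · exact h h'
    · exact (h h').symm
  · ext v; rfl

/-- Every cover of the cone over cycles has at least as many colorings as one in normal form. -/
theorem exists_card_isTwistedColoring_le [Finite ι] {m : ℕ} {W : Type*} [Finite W]
    {H : SimpleGraph W} {L : (Unit ⊕ Σ i, Fin (k i + 3)) → Set W}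
    (hc : IsCover (coneOfCycles k) H L) (hm : IsFold L m) :
    ∃ σ : ∀ i, Fin (k i + 3) → Equiv.Perm (Fin m), Nat.card {c // IsTwistedColoring σ c} ≤
      (coverColorings (Unit ⊕ Σ i, Fin (k i + 3)) H).ncard := by
  have hstep : ∀ {u v}, (coneOfCycles k).Adj u v → ∀ e : Fin m ≃ L u, ∃ g : Fin m ≃ L v,
      ∀ i, ∀ b ∈ L v, H.Adj (e i) b → (g i : W) = b := by
    intro u v huv e
    refine exists_equiv_of_matching e (hm v) H.Adj ?_ ?_
    · intro a ha b hb c hc' hab hac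
      exact hc.matching huv ha hb hc' hab hac
    · intro a ha c hc' b hb hab hcb
      exact hc.matching huv.symm hb ha hc' hab.symm hcb.symm
  obtain ⟨e⟩ : Nonempty (Fin m ≃ L (Sum.inl ())) :=
    ⟨(Finite.equivFinOfCardEq (by rw [Nat.card_coe_set_eq]; exact hm _)).symm⟩
  choose g hg using fun x => hstep (coneOfCycles_adj.2 (Or.inl (Or.inl ⟨x, rfl, rfl⟩))) e
  choose s hs using fun i t => hstep
    (coneOfCycles_adj.2 (Or.inl (Or.inr ⟨i, t, rfl, rfl⟩))) (g ⟨i, t⟩)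
  -- These labels of the parts are transported from the apex along the spokes, so that the spokes
  -- become identities.
  let φ : ∀ v, Fin m ≃ L v := fun v => match v with
    | Sum.inl () => e
    | Sum.inr x => g x
  have hφ : ∀ u v a b, (φ u a : W) = φ v b → u = v := fun u v a b h =>
    hc.eq_of_mem (φ u a).2 (h ▸ (φ v b).2)
  refine ⟨fun i t => (s i t).trans (g ⟨i, t + 1⟩).symm, ?_⟩
  rw [← Nat.card_coe_set_eq]
  refine Nat.card_le_card_of_injective
    (fun c => ⟨Set.range fun v => (φ v (c.1 v) : W), ?_, ?_⟩) ?_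
  · have harc : ∀ {u v}, Arc k u v → ¬ H.Adj (φ u (c.1 u)) (φ v (c.1 v)) := by
      rintro u v (⟨x, rfl, rfl⟩ | ⟨i, t, rfl, rfl⟩) h
      · have := hg x _ _ (φ (Sum.inr x) (c.1 (Sum.inr x))).2 h
        exact c.2.1 x ((g x).injective (Subtype.ext this)).symm
      · have := hs i t _ _ (φ (Sum.inr ⟨i, t + 1⟩) (c.1 (Sum.inr ⟨i, t + 1⟩))).2 h
        refine c.2.2 i t ?_
        rw [Equiv.trans_apply, Equiv.eq_symm_apply]
        exact (Subtype.ext this).symm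
    rintro _ ⟨u, rfl⟩ _ ⟨v, rfl⟩ hne hadj
    rcases hc.eq_or_adj (φ u (c.1 u)).2 (φ v (c.1 v)).2 hadj with rfl | huv
    · exact hne rfl
    · rcases coneOfCycles_adj.1 huv with h | h
      · exact harc h hadj
      · exact harc h hadj.symm
  · exact Set.ncard_range_of_injective fun u v h => hφ _ _ _ _ h
  · intro c d hcd
    apply Subtype.ext
    funext v
    have h1 : (φ v (c.1 v) : W) ∈ Set.range fun v => (φ v (d.1 v) : W) := by
      have := congrArg Subtype.val hcd
      dsimp only at this
      rw [← this]
      exact ⟨v, rfl⟩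
    obtain ⟨u, hu⟩ := h1
    obtain rfl := hφ _ _ _ _ hu
    exact (φ u).injective (Subtype.ext hu.symm)

/-- The edges of the cover in normal form between different parts. -/
def TwistedArc {m : ℕ} (σ : ∀ i, Fin (k i + 3) → Equiv.Perm (Fin m))
    (p q : (Unit ⊕ Σ i, Fin (k i + 3)) × Fin m) : Prop :=
  (∃ x a, p = (Sum.inl (), a) ∧ q = (Sum.inr x, a)) ∨
    ∃ i t a, p = (Sum.inr ⟨i, t⟩, a) ∧ q = (Sum.inr ⟨i, t + 1⟩, σ i t a)

/-- The cover graph in normal form. -/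
def twistedCover {m : ℕ} (σ : ∀ i, Fin (k i + 3) → Equiv.Perm (Fin m)) :
    SimpleGraph ((Unit ⊕ Σ i, Fin (k i + 3)) × Fin m) :=
  SimpleGraph.fromRel fun p q => p.1 = q.1 ∨ TwistedArc σ p q

theorem TwistedArc.arc {m : ℕ} {σ : ∀ i, Fin (k i + 3) → Equiv.Perm (Fin m)}
    {p q : (Unit ⊕ Σ i, Fin (k i + 3)) × Fin m} (h : TwistedArc σ p q) : Arc k p.1 q.1 := by
  rcases h with ⟨x, a, rfl, rfl⟩ | ⟨i, t, a, rfl, rfl⟩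
  · exact Or.inl ⟨x, rfl, rfl⟩
  · exact Or.inr ⟨i, t, rfl, rfl⟩

/-- On a rim, arcs in both directions would need `t + 2 = t`, impossible for length at least 3.
Hence two parts of the normal form are joined by a single matching. -/
theorem Arc.asymm {u v : Unit ⊕ Σ i, Fin (k i + 3)} (h : Arc k u v) : ¬ Arc k v u := by
  rintro (⟨y, rfl, rfl⟩ | ⟨j, s, rfl, rfl⟩)
  · rcases h with ⟨x, h, -⟩ | ⟨i, t, -, h⟩ <;> cases h
  · rcases h with ⟨x, h, -⟩ | ⟨i, t, h, h'⟩
    · cases h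
    · rw [Sum.inr.injEq, Sigma.mk.inj_iff] at h h'
      obtain ⟨rfl, h⟩ := h
      have h1 := eq_of_heq h
      have h2 := eq_of_heq h'.2
      rw [← h1, add_assoc, left_eq_add] at h2
      have := congrArg Fin.val h2
      rw [Fin.val_add, Fin.val_one, Fin.val_zero, Nat.mod_eq_of_lt (by omega)] at this
      omega

theorem TwistedArc.right_unique {m : ℕ} {σ : ∀ i, Fin (k i + 3) → Equiv.Perm (Fin m)}
    {p q r : (Unit ⊕ Σ i, Fin (k i + 3)) × Fin m} (hq : TwistedArc σ p q) (hr : TwistedArc σ p r)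
    (h : q.1 = r.1) : q = r := by
  refine Prod.ext h ?_
  rcases hq with ⟨x, a, rfl, rfl⟩ | ⟨i, t, a, rfl, rfl⟩
  · rcases hr with ⟨y, b, hb, rfl⟩ | ⟨j, s, b, hb, rfl⟩
    · exact (Prod.ext_iff.1 hb).2
    · cases hb
  · rcases hr with ⟨y, b, hb, rfl⟩ | ⟨j, s, b, hb, rfl⟩
    · cases hb
    · cases hb
      rfl

theorem TwistedArc.left_unique {m : ℕ} {σ : ∀ i, Fin (k i + 3) → Equiv.Perm (Fin m)}
    {p q r : (Unit ⊕ Σ i, Fin (k i + 3)) × Fin m} (hq : TwistedArc σ q p) (hr : TwistedArc σ r p)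
    (h : q.1 = r.1) : q = r := by
  refine Prod.ext h ?_
  rcases hq with ⟨x, a, rfl, rfl⟩ | ⟨i, t, a, rfl, rfl⟩
  · rcases hr with ⟨y, b, rfl, hb⟩ | ⟨j, s, b, rfl, hb⟩
    · exact (Prod.ext_iff.1 hb).2
    · cases h
  · rcases hr with ⟨y, b, rfl, hb⟩ | ⟨j, s, b, rfl, hb⟩
    · cases h
    · cases h
      exact (σ i t).injective (congrArg Prod.snd hb)

theorem isCover_twistedCover {m : ℕ} (hm : 1 ≤ m)
    (σ : ∀ i, Fin (k i + 3) → Equiv.Perm (Fin m)) :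
    IsCover (coneOfCycles k) (twistedCover σ) fun v => {p | p.1 = v} := by
  have hinj : Function.Injective fun v : Unit ⊕ Σ i, Fin (k i + 3) =>
      {p : (Unit ⊕ Σ i, Fin (k i + 3)) × Fin m | p.1 = v} := by
    intro u v h
    have : (u, (⟨0, hm⟩ : Fin m)) ∈ {p : (Unit ⊕ Σ i, Fin (k i + 3)) × Fin m | p.1 = v} :=
      (Set.ext_iff.1 h _).1 rfl
    exact this
  refine ⟨⟨?_, fun p => ⟨_, ⟨⟨p.1, rfl⟩, rfl⟩, ?_⟩⟩, hinj, ?_, ?_, ?_⟩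
  · rintro ⟨v, hv⟩
    have : (v, (⟨0, hm⟩ : Fin m)) ∈ {p : (Unit ⊕ Σ i, Fin (k i + 3)) × Fin m | p.1 = v} := rfl
    rw [show {p : (Unit ⊕ Σ i, Fin (k i + 3)) × Fin m | p.1 = v} = ∅ from hv] at this
    exact this
  · rintro _ ⟨⟨v, rfl⟩, h⟩
    have h' : p.1 = v := h
    rw [h']
  · rintro v p rfl q hq hne
    exact ⟨hne, Or.inl (Or.inl (Eq.symm hq))⟩
  · rintro u v p q rfl rfl ⟨-, (h | h) | (h | h)⟩
    · exact Or.inl h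
    · exact Or.inr (coneOfCycles_adj.2 (Or.inl h.arc))
    · exact Or.inl h.symm
    · exact Or.inr (coneOfCycles_adj.2 (Or.inr h.arc))
  · rintro u v huv p q r rfl hq hr ⟨-, hpq⟩ ⟨-, hpr⟩
    have hq : q.1 = v := hq
    have hr : r.1 = v := hr
    have hqr : q.1 = r.1 := hq.trans hr.symm
    have h1 : p.1 ≠ q.1 := hq ▸ huv.ne
    have h2 : p.1 ≠ r.1 := hr ▸ huv.ne
    rcases hpq with (h | hpq) | (h | hpq)
    · exact absurd h h1
    · rcases hpr with (h | hpr) | (h | hpr)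
      · exact absurd h h2
      · exact hpq.right_unique hpr hqr
      · exact absurd h.symm h2
      · exact absurd hpr.arc (hqr ▸ hpq.arc.asymm)
    · exact absurd h.symm h1
    · rcases hpr with (h | hpr) | (h | hpr)
      · exact absurd h h2
      · exact absurd hpr.arc (hqr ▸ hpq.arc.asymm)
      · exact absurd h.symm h2
      · exact hpq.left_unique hpr hqr

theorem ncard_coverColorings_twistedCover_le [Finite ι] {m : ℕ}
    (σ : ∀ i, Fin (k i + 3) → Equiv.Perm (Fin m)) :
    (coverColorings (Unit ⊕ Σ i, Fin (k i + 3)) (twistedCover σ)).ncard ≤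
      Nat.card {c // IsTwistedColoring σ c} := by
  rw [← Nat.card_coe_set_eq]
  refine Nat.card_le_card_of_surjective
    (f := fun c => (⟨Set.range fun v => (v, c.1 v), ?_, ?_⟩ : coverColorings _ (twistedCover σ))) ?_
  · have harc : ∀ u v, ¬ TwistedArc σ (u, c.1 u) (v, c.1 v) := by
      rintro u v (⟨x, a, hu, hv⟩ | ⟨i, t, a, hu, hv⟩)
      · rw [Prod.mk.injEq] at hu hv
        obtain ⟨rfl, hu⟩ := hu
        obtain ⟨rfl, hv⟩ := hv
        exact c.2.1 x (hv.trans hu.symm)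
      · rw [Prod.mk.injEq] at hu hv
        obtain ⟨rfl, hu⟩ := hu
        obtain ⟨rfl, hv⟩ := hv
        exact c.2.2 i t (by rw [hv, hu])
    rintro _ ⟨u, rfl⟩ _ ⟨v, rfl⟩ hne ⟨-, (h | h) | (h | h)⟩
    · have h : u = v := h
      exact hne (by rw [h])
    · exact harc _ _ h
    · have h : v = u := h
      exact hne (by rw [h])
    · exact harc _ _ h
  · exact Set.ncard_range_of_injective fun u v h => congrArg Prod.fst h
  · rintro ⟨I, hI, hcard⟩
    -- The parts are cliques, so an independent set of full size meets each part exactly once and is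
    -- the graph of a function.
    have hinj : Set.InjOn Prod.fst I := by
      intro p hp q hq h
      by_contra hne
      exact hI hp hq hne ⟨hne, Or.inl (Or.inl h)⟩
    have huniv : Prod.fst '' I = Set.univ := by
      apply Set.eq_of_subset_of_ncard_le (Set.subset_univ _)
      rw [Set.ncard_univ, hinj.ncard_image, hcard]
    have hex : ∀ v, ∃ a, (v, a) ∈ I := by
      intro v
      obtain ⟨p, hp, rfl⟩ : v ∈ Prod.fst '' I := huniv ▸ Set.mem_univ v
      exact ⟨p.2, hp⟩
    choose c hc using hex
    have hno : ∀ {p q}, p ∈ I → q ∈ I → ¬ (TwistedArc σ p q ∧ p ≠ q) := fun hp hq h =>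
      hI hp hq h.2 ⟨h.2, Or.inl (Or.inr h.1)⟩
    refine ⟨⟨c, fun x h => ?_, fun i t h => ?_⟩, Subtype.ext ?_⟩
    · refine hno (hc (Sum.inl ())) (hc (Sum.inr x)) ⟨Or.inl ⟨x, _, rfl, by rw [h]⟩, ?_⟩
      simp
    · refine hno (hc (Sum.inr ⟨i, t⟩)) (hc (Sum.inr ⟨i, t + 1⟩))
        ⟨Or.inr ⟨i, t, _, rfl, by rw [h]⟩, ?_⟩
      simp
    · ext p
      constructor
      · rintro ⟨v, rfl⟩
        exact hc v
      · intro hp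
        exact ⟨p.1, hinj (hc p.1) hp rfl⟩

end Cone

/-! ### The DP color function and its threshold -/

section Threshold

variable {ι : Type} [Fintype ι] {k : ι → ℕ}

/-- The trivial `σ` gives the bound by the chromatic count; a nontrivial one gives the strict
inequality for 3 colors. -/
theorem dpColorFunction_coneOfCycles_le {m : ℕ} (hm : 1 ≤ m)
    (σ : ∀ i, Fin (k i + 3) → Equiv.Perm (Fin m)) :
    dpColorFunction (coneOfCycles k) m ≤ ∑ j, ∏ i, twistCount (n := k i + 2) (σ i) j := by
  rw [← card_isTwistedColoring]
  refine le_trans ((dpColorFunction_isLeast _ hm).2 ⟨_, inferInstance, twistedCover σ, _,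
    isCover_twistedCover hm σ, fun v => ?_, rfl⟩) (ncard_coverColorings_twistedCover_le σ)
  have : {p : (Unit ⊕ Σ i, Fin (k i + 3)) × Fin m | p.1 = v} = Set.range fun a => (v, a) := by
    ext ⟨u, a⟩
    simp [eq_comm]
  dsimp only
  rw [this, Set.ncard_range_of_injective fun a b h => congrArg Prod.snd h]
  simp

theorem cast_chromaticCount_coneOfCycles {m : ℕ} (hm : 2 ≤ m) :
    (chromaticCount (coneOfCycles k) m : ℝ) = m * ∏ i, cycleValue m (k i + 2) := by
  rw [chromaticCount_coneOfCycles]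
  push_cast
  have h : ∀ (j : Fin m) (n : ℕ),
      (twistCount (fun _ : Fin (n + 1) => (1 : Equiv.Perm (Fin m))) j : ℝ) = cycleValue m n := by
    intro j n
    have := congrArg (Int.cast : ℤ → ℝ) (twistCount_one (n := n) hm j)
    push_cast at this
    exact this
  rw [Finset.sum_congr rfl fun j _ => Finset.prod_congr rfl fun i _ => h j (k i + 2)]
  simp

theorem dpColorFunction_coneOfCycles_eq (hfour : ∀ p q, k p = 1 → k q = 1 → p = q) {m : ℕ}
    (hm : 4 ≤ m) : dpColorFunction (coneOfCycles k) m = chromaticCount (coneOfCycles k) m := by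
  apply le_antisymm
  · rw [chromaticCount_coneOfCycles]
    exact dpColorFunction_coneOfCycles_le (by omega) fun i _ => 1
  · obtain ⟨W, _, H, L, hc, hL, hcard⟩ := (dpColorFunction_isLeast (coneOfCycles k)
      (show 1 ≤ m by omega)).1
    obtain ⟨σ, hσ⟩ := exists_card_isTwistedColoring_le hc hL
    rw [hcard]
    refine le_trans ?_ hσ
    have h := mul_prod_cycleValue_le (fun i => k i + 2) hm (fun i => by omega)
      (fun p q hp hq => hfour p q (by omega) (by omega)) σ
    rw [← cast_chromaticCount_coneOfCycles (by omega)] at h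
    rw [card_isTwistedColoring]
    exact_mod_cast h

/-- Only two colors are available, so the first `n` steps alternate and, `n` being odd, end at the
color `z` other than the start `x`. The closing step excludes `x = finRotate 3 z`, which holds for
exactly one of the two choices. -/
theorem twistCount_rotate_le {n : ℕ} (hn : Odd n) (j : Fin 3) :
    twistCount (fun t : Fin (n + 1) => if t = Fin.last n then finRotate 3 else 1) j ≤ 1 := by
  classical
  have hdec : ∀ j : Fin 3, ∑ x : {x : Fin 3 // x ≠ j}, ∑ z : {x : Fin 3 // x ≠ j},
      (if x.1 ≠ finRotate 3 z.1 ∧ z ≠ x then 1 else 0) = 1 := by decide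
  refine le_trans ?_ (hdec j).le
  unfold twistCount
  rw [closedWalkCount_eq_sum]
  refine Finset.sum_le_sum fun x _ => ?_
  rw [walkCount_succ]
  refine Finset.sum_le_sum fun z _ => ?_
  obtain ⟨p, hp, hW⟩ := card_mul_walkCount_perm
    fun _ : Fin n => (1 : Equiv.Perm {x : Fin 3 // x ≠ j})
  have hp1 : p x = x := hp x fun _ => rfl
  have h := hW x z
  rw [card_colors_ne, hn.neg_one_pow, hp1] at h
  have h2 : walkCount (fun (t : Fin n) (a b : {x : Fin 3 // x ≠ j}) =>
      b.1 ≠ (if t.castSucc = Fin.last n then finRotate 3 else 1 : Equiv.Perm (Fin 3)) a.1) x z ≤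
      walkCount (fun (t : Fin n) a b => b ≠ (1 : Equiv.Perm {x : Fin 3 // x ≠ j}) a) x z := by
    refine walkCount_mono (fun t a b hab => ?_) x z
    rw [if_neg (Fin.castSucc_lt_last t).ne] at hab
    exact fun h => hab (congrArg Subtype.val h)
  simp only [if_true]
  generalize walkCount (fun (t : Fin n) a b => b ≠ (1 : Equiv.Perm {x : Fin 3 // x ≠ j}) a) x z = w
    at h h2
  by_cases hzx : z = x
  · rw [if_neg (fun h => h.2 hzx : ¬(x.1 ≠ finRotate 3 z.1 ∧ z ≠ x))]
    rw [if_pos hzx] at h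
    norm_num at h
    subst h
    split_ifs
    · exact h2
    · exact le_rfl
  · rw [if_neg hzx] at h
    norm_num at h
    obtain rfl : w = 1 := by omega
    split_ifs with h3 h4 h4
    · exact h2
    · exact absurd ⟨h3, hzx⟩ h4
    · exact Nat.zero_le _
    · exact Nat.zero_le _

/-- An odd cycle would make the chromatic count vanish, so all cycles are even and each has 2
colorings per apex color. Twisting one edge of one cycle leaves at most 1 for that cycle. -/
theorem dpColorFunction_coneOfCycles_three_lt [Nonempty ι]
    (hcol : (coneOfCycles k).Colorable 3) :
    dpColorFunction (coneOfCycles k) 3 < chromaticCount (coneOfCycles k) 3 := by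
  classical
  have hone : ∀ i (j : Fin 3), (twistCount (n := k i + 2) (fun _ => (1 : Equiv.Perm (Fin 3))) j : ℤ) =
      1 + (-1) ^ (k i + 3) := by
    intro i j
    rw [twistCount_one (by norm_num)]
    norm_num
  have hodd : ∀ i, Odd (k i + 2) := by
    intro i
    by_contra hi
    have hev : Odd (k i + 3) := (Nat.not_odd_iff_even.1 hi).add_one
    have h0 : chromaticCount (coneOfCycles k) 3 = 0 := by
      rw [chromaticCount_coneOfCycles]
      refine Finset.sum_eq_zero fun j _ => Finset.prod_eq_zero (mem_univ i) ?_
      have := hone i j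
      rw [hev.neg_one_pow] at this
      simpa using this
    have : Finite ((coneOfCycles k).Coloring (Fin 3)) :=
      Finite.of_injective (fun c => (c : _ → Fin 3)) DFunLike.coe_injective
    have : Nonempty ((coneOfCycles k).Coloring (Fin 3)) := hcol
    exact Nat.card_pos.ne' h0
  have htwo : ∀ i (j : Fin 3), twistCount (n := k i + 2) (fun _ => (1 : Equiv.Perm (Fin 3))) j = 2 := by
    intro i j
    have := hone i j
    rw [show (-1 : ℤ) ^ (k i + 3) = 1 from (hodd i).add_one.neg_one_pow] at this
    exact_mod_cast this
  obtain ⟨i₀⟩ := ‹Nonempty ι›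
  refine (dpColorFunction_coneOfCycles_le (by norm_num) fun i t =>
    if i = i₀ then (if t = Fin.last (k i + 2) then finRotate 3 else 1) else 1).trans_lt ?_
  rw [chromaticCount_coneOfCycles]
  refine Finset.sum_lt_sum_of_nonempty univ_nonempty fun j _ => ?_
  rw [← Finset.mul_prod_erase _ _ (mem_univ i₀),
    ← Finset.mul_prod_erase univ (fun i => twistCount (n := k i + 2) _ j) (mem_univ i₀)]
  have h1 : ∏ i ∈ univ.erase i₀, twistCount (n := k i + 2) (fun t =>
      if i = i₀ then (if t = Fin.last (k i + 2) then finRotate 3 else 1) else 1) j =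
      ∏ i ∈ univ.erase i₀, twistCount (n := k i + 2) (fun _ => (1 : Equiv.Perm (Fin 3))) j := by
    refine Finset.prod_congr rfl fun i hi => ?_
    simp only [if_neg (Finset.mem_erase.1 hi).1]
  rw [h1]
  refine Nat.mul_lt_mul_of_pos_right ?_ (Finset.prod_pos fun i _ => by rw [htwo]; norm_num)
  rw [htwo]
  simp only [if_true]
  exact (twistCount_rotate_le (hodd i₀) j).trans_lt (by norm_num)

theorem dpThreshold_coneOfCycles [Nonempty ι] (hfour : ∀ p q, k p = 1 → k q = 1 → p = q) :
    dpThreshold (coneOfCycles k) = 4 := by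
  unfold dpThreshold
  apply le_antisymm
  · refine iInf₂_le 4 ⟨?_, fun m hm => dpColorFunction_coneOfCycles_eq hfour hm⟩
    rw [SimpleGraph.chromaticNumber_le_iff_colorable]
    have hpos : (0 : ℝ) < chromaticCount (coneOfCycles k) 4 := by
      rw [cast_chromaticCount_coneOfCycles (by norm_num)]
      exact mul_pos (by norm_num) (Finset.prod_pos fun i _ => cycleValue_pos le_rfl (by omega))
    have hpos' : 0 < chromaticCount (coneOfCycles k) 4 := by exact_mod_cast hpos
    exact (Nat.card_pos_iff.1 hpos').1
  · refine le_iInf₂ fun N hN => ?_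
    by_contra h
    -- An admissible `N` below 4 would make the cone 3-colorable and also force equality at `m = 3`.
    have hN3 : N ≤ 3 := by
      rw [not_le] at h
      have : N < 4 := by exact_mod_cast h
      omega
    have hcol : (coneOfCycles k).Colorable 3 :=
      (SimpleGraph.chromaticNumber_le_iff_colorable.1 hN.1).mono hN3
    exact (dpColorFunction_coneOfCycles_three_lt hcol).ne (hN.2 3 hN3)

end Threshold

end DPColoring

theorem mainTheorem9 (n : ℕ) (hn : 2 ≤ n) (k : Fin n → ℕ) (hk : ∀ i, 3 ≤ k i)
    (hfour : ∀ p q : Fin n, k p = 4 → k q = 4 → p = q) :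
    DPColoring.dpColorFunction
        (DPColoring.cone (DPColoring.disjointUnion fun i => SimpleGraph.cycleGraph (k i))) 4 =
      DPColoring.chromaticCount
        (DPColoring.cone (DPColoring.disjointUnion fun i => SimpleGraph.cycleGraph (k i))) 4 ∧
    DPColoring.dpThreshold
        (DPColoring.cone (DPColoring.disjointUnion fun i => SimpleGraph.cycleGraph (k i))) = 4 := by
  -- With lengths written `l i + 3`, a 4-cycle is the case `l i = 1`.
  obtain ⟨l, rfl⟩ : ∃ l : Fin n → ℕ, k = fun i => l i + 3 :=
    ⟨fun i => k i - 3, funext fun i => (Nat.sub_add_cancel (hk i)).symm⟩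
  have : Nonempty (Fin n) := ⟨⟨0, by omega⟩⟩
  have hl : ∀ p q, l p = 1 → l q = 1 → p = q := fun p q hp hq =>
    hfour p q (by simp [hp]) (by simp [hq])
  exact ⟨DPColoring.dpColorFunction_coneOfCycles_eq hl le_rfl,
    DPColoring.dpThreshold_coneOfCycles hl⟩
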